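/- For $p\ge 2$ let $\Sigma_p=\{0,\dots,p-1\}^{\mathbb{N}_0}$ with the metric $\varrho(x,y)=2^{-\min\{i:\,x_i\ne y_i\}}$ for $x\ne y$, and let $\sigma(x_0x_1x_2\dots)=x_1x_2\dots$ be the shift. A subshift $(X,\sigma)$ is the restriction of $\sigma$ to a nonempty closed set $X\subseteq\Sigma_p$ with $\sigma(X)\subseteq X$. For $y,z\in X$, $\varepsilon>0$ and $m,n\ge 1$ put $$\varrho_m(y,z)=\max_{0\le i<m}\varrho(\sigma^i y,\sigma^i z),\qquad C_m(y,n,\varepsilon)=\frac{1}{n^2}\,\#\{(i,j):0\le i,j<n,\ \varrho_m(\sigma^i y,\sigma^j y)\le\varepsilon\}.$$ The upper and lower local correlation entropies of $\sigma$ at $y$ are $$\lim_{\varepsilon\to0}\limsup_{m\to\infty}-\frac1m\log\liminf_{n\to\infty}C_m(y,n,\varepsilon)\quad\text{and}\quad\lim_{\varepsilon\to0}\liminf_{m\to\infty}-\frac1m\log\limsup_{n\to\infty}C_m(y,n,\varepsilon);$$ the upper and lower correlation entropies of an invariant Borel probability measure $\mu$ are $$\lim_{\varepsilon\to0}\limsup_{m\to\infty}-\frac1m\log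 c_m(\mu,\varepsilon)\quad\text{and}\quad\lim_{\varepsilon\to0}\liminf_{m\to\infty}-\frac1m\log c_m(\mu,\varepsilon),\qquad c_m(\mu,\varepsilon)=(\mu\times\mu)\{(y,z):\varrho_m(y,z)\le\varepsilon\}.$$ In either case, if the upper and lower values coincide, the common value is called the (local) correlation entropy. **Theorem C.** There are $p\ge 2$ and a subshift $(X,\sigma)$, $X\subseteq\Sigma_p$, such that (a) $(X,\sigma)$ is strictly ergodic, that is, minimal (no nonempty proper closed subset $A\subset X$ satisfies $\sigma(A)\subseteq A$) and uniquely ergodic (there is exactly one $\sigma$-invariant Borel probability measure on $X$); (b) $(X,\sigma)$ has positive topological entropy; (c) at every $y\in X$ the local correlation entropy of $\sigma$ exists and is zero; (d) the correlation entropy of $\sigma$ with respect to the unique invariant measure $\mu$ exists and is zero. -/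

import Mathlib

open Set Filter Topology MeasureTheory
open scoped ENNReal NNReal

noncomputable section

/-! ### Minimality, unique ergodicity, strict ergodicity -/

/-- A Borel probability measure that is invariant under `f`. -/
def IsInvariantProbability {X : Type*} [MeasurableSpace X] (f : X → X) (μ : Measure X) : Prop :=
  IsProbabilityMeasure μ ∧ MeasurePreserving f μ μ

/-- `(X, f)` is minimal: `X` is nonempty and has no nonempty proper closed subset `A` with
`f(A) ⊆ A`. -/
def IsMinimalSystem {X : Type*} [TopologicalSpace X] (f : X → X) : Prop :=
  Nonempty X ∧ ∀ A : Set X, IsClosed A → MapsTo f A A → A.Nonempty → A = univ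

/-- `(X, f)` is uniquely ergodic: it has exactly one invariant Borel probability measure. -/
def IsUniquelyErgodic {X : Type*} [MeasurableSpace X] (f : X → X) : Prop :=
  ∃! μ : Measure X, IsInvariantProbability f μ

/-- `(X, f)` is strictly ergodic: minimal and uniquely ergodic. -/
def IsStrictlyErgodic {X : Type*} [TopologicalSpace X] [MeasurableSpace X] (f : X → X) : Prop :=
  IsMinimalSystem f ∧ IsUniquelyErgodic f

/-! ### Correlation sums, correlation integrals, correlation entropies -/

section Correlation

variable {X : Type*} [PseudoMetricSpace X]

/-- Bowen's metric `ϱ_m(y, z) = max_{0 ≤ i < m} ϱ(f^i y, f^i z)`. -/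
def bowenDist (f : X → X) (m : ℕ) (y z : X) : ℝ :=
  ((Finset.range m).sup fun i => nndist (f^[i] y) (f^[i] z) : ℝ≥0)

/-- The correlation sum `C_m(x, n, ε)`: the proportion, among the `n ^ 2` pairs `(i, j)` with
`0 ≤ i, j < n`, of those with `ϱ_m(f^i x, f^j x) ≤ ε`. -/
def correlationSum (f : X → X) (m : ℕ) (x : X) (n : ℕ) (ε : ℝ) : ℝ≥0∞ :=
  (Set.ncard {q : ℕ × ℕ | q.1 < n ∧ q.2 < n ∧ bowenDist f m (f^[q.1] x) (f^[q.2] x) ≤ ε} : ℝ≥0∞)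
    / (n : ℝ≥0∞) ^ 2

/-- The limit inferior, as `n → ∞`, of the correlation sums. -/
def lowerCorrelationSum (f : X → X) (m : ℕ) (x : X) (ε : ℝ) : ℝ≥0∞ :=
  liminf (fun n : ℕ => correlationSum f m x n ε) atTop

/-- The limit superior, as `n → ∞`, of the correlation sums. -/
def upperCorrelationSum (f : X → X) (m : ℕ) (x : X) (ε : ℝ) : ℝ≥0∞ :=
  limsup (fun n : ℕ => correlationSum f m x n ε) atTop

/-- The upper local correlation entropy
`lim_{ε → 0} limsup_{m → ∞} (-1/m) log (liminf_{n → ∞} C_m(x, n, ε))` of `f` at `x` is `h`. -/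
def HasUpperLocalCorrelationEntropy (f : X → X) (x : X) (h : EReal) : Prop :=
  Tendsto
    (fun ε : ℝ => limsup (fun m : ℕ => -ENNReal.log (lowerCorrelationSum f m x ε) / (m : EReal))
      atTop)
    (𝓝[>] 0) (𝓝 h)

/-- The lower local correlation entropy
`lim_{ε → 0} liminf_{m → ∞} (-1/m) log (limsup_{n → ∞} C_m(x, n, ε))` of `f` at `x` is `h`. -/
def HasLowerLocalCorrelationEntropy (f : X → X) (x : X) (h : EReal) : Prop :=
  Tendsto
    (fun ε : ℝ => liminf (fun m : ℕ => -ENNReal.log (upperCorrelationSum f m x ε) / (m : EReal))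
      atTop)
    (𝓝[>] 0) (𝓝 h)

/-- The local correlation entropy of `f` at `x` exists and is `h`: the upper and the lower one are
both equal to `h`. -/
def HasLocalCorrelationEntropy (f : X → X) (x : X) (h : EReal) : Prop :=
  HasUpperLocalCorrelationEntropy f x h ∧ HasLowerLocalCorrelationEntropy f x h

variable [MeasurableSpace X]

/-- The correlation integral `(μ × μ) {(y, z) | ϱ_m(y, z) ≤ ε}`. -/
def correlationIntegral (f : X → X) (m : ℕ) (μ : Measure X) (ε : ℝ) : ℝ≥0∞ :=
  (μ.prod μ) {q : X × X | bowenDist f m q.1 q.2 ≤ ε}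

/-- The upper correlation entropy of `f` with respect to `μ` (the limit, as `ε → 0`, of the limit
superior, as `m → ∞`, of `(-1/m) log` of the correlation integral) is `h`. -/
def HasUpperCorrelationEntropy (f : X → X) (μ : Measure X) (h : EReal) : Prop :=
  Tendsto
    (fun ε : ℝ => limsup (fun m : ℕ => -ENNReal.log (correlationIntegral f m μ ε) / (m : EReal))
      atTop)
    (𝓝[>] 0) (𝓝 h)

/-- The lower correlation entropy of `f` with respect to `μ` (the limit, as `ε → 0`, of the limit
inferior, as `m → ∞`, of `(-1/m) log` of the correlation integral) is `h`. -/
def HasLowerCorrelationEntropy (f : X → X) (μ : Measure X) (h : EReal) : Prop :=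
  Tendsto
    (fun ε : ℝ => liminf (fun m : ℕ => -ENNReal.log (correlationIntegral f m μ ε) / (m : EReal))
      atTop)
    (𝓝[>] 0) (𝓝 h)

/-- The correlation entropy of `f` with respect to `μ` exists and is `h`: the upper and the lower
one are both equal to `h`. -/
def HasCorrelationEntropy (f : X → X) (μ : Measure X) (h : EReal) : Prop :=
  HasUpperCorrelationEntropy f μ h ∧ HasLowerCorrelationEntropy f μ h

end Correlation

/-! ### One-sided subshifts -/

/-- The metric `ϱ(x, y) = 2 ^ (-min {i | x i ≠ y i})` (for `x ≠ y`) on the one-sided full shift on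
`p` symbols. Its topology is the product topology. -/
instance fullShiftMetricSpace (p : ℕ) : MetricSpace (ℕ → Fin p) := PiNat.metricSpace

/-- The shift `(x_0, x_1, …) ↦ (x_1, x_2, …)`, restricted to a one-sided subshift. -/
def subshiftMap {p : ℕ} (X : SymbolicDynamics.FullShift.Subshift (Fin p) ℕ) :
    X.carrier → X.carrier :=
  (X.mapsTo 1).restrict (SymbolicDynamics.FullShift.shift 1) X.carrier X.carrier

end

/-! The subshift is the orbit closure of a sequence built from a hierarchy of blocks. A block of
level `k + 1` is a run of `r` copies of the block `0` of level `k`, followed by all `N` blocks of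
level `k`, each once, in an arbitrary order; so there are `N!` of them. The run has relative length
about `2 ^ -(k + 3)`. This is summable, so the run hardly lowers the entropy, yet it decays so
slowly that one word per length stays frequent.

Entropy: by Stirling, `log N!` is about `N log N`, while lengths grow by the factor `r + N`. The
relative losses form a convergent product, so the number of blocks stays exponential in their length
(`mul_blockLen_le_log_blockCount`).

Strict ergodicity: a block of level `k + 1` contains each block of level `k`, with multiplicities
independent of the block (`sum_blockChild`). Hence words recur with bounded gaps
(`exists_prefix_occurrence`) and have uniform frequencies (`exists_window_count_bounds`).

Correlation entropy: two visits to one cylinder form a close pair, so a correlation sum is at least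
a constant times the square of the frequency of any single word. The periodic words read in the runs
have frequency at least of order `n ^ -2` in their length `n` (`exists_frequent_word`), so
correlation sums and integrals decay only polynomially
(`hasCorrelationEntropy_zero_of_frequent_sets`). -/

/-! ### The hierarchy of blocks and its limit sequence -/

open Nat in
/-- For `t < N!`, `q ↦ permEnum N t q` is the `t`-th permutation of `{0, …, N - 1}`. -/
noncomputable def permEnum (N t q : ℕ) : ℕ :=
  if h : t < N ! ∧ q < N then
    ((Fintype.equivOfCardEq (by simp [Fintype.card_perm]) : Fin (N !) ≃ Equiv.Perm (Fin N))
      ⟨t, h.1⟩ ⟨q, h.2⟩ : ℕ)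
  else 0

open Nat in
theorem exists_permEnum_equiv (N : ℕ) : ∃ E : Fin (N !) ≃ Equiv.Perm (Fin N),
    ∀ (t : Fin (N !)) (q : Fin N), permEnum N t q = E t q :=
  ⟨Fintype.equivOfCardEq (by simp [Fintype.card_perm]), fun t q => by simp [permEnum]⟩

open Nat in
theorem permEnum_lt {N t q : ℕ} (ht : t < N !) (hq : q < N) : permEnum N t q < N := by
  obtain ⟨E, hE⟩ := exists_permEnum_equiv N
  rw [hE ⟨t, ht⟩ ⟨q, hq⟩]; exact Fin.isLt _

open Nat in
theorem exists_permEnum_eq {N t u : ℕ} (ht : t < N !) (hu : u < N) :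
    ∃ q < N, permEnum N t q = u := by
  obtain ⟨E, hE⟩ := exists_permEnum_equiv N
  obtain ⟨q, hq⟩ := (E ⟨t, ht⟩).surjective ⟨u, hu⟩
  exact ⟨q, q.2, by rw [hE ⟨t, ht⟩ q, hq]⟩

open Nat in
theorem exists_permEnum_ne {N t t' : ℕ} (ht : t < N !) (ht' : t' < N !) (h : t ≠ t') :
    ∃ q < N, permEnum N t q ≠ permEnum N t' q := by
  obtain ⟨E, hE⟩ := exists_permEnum_equiv N
  by_contra! H
  refine h (congrArg Fin.val (E.injective (a₁ := ⟨t, ht⟩) (a₂ := ⟨t', ht'⟩) ?_))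
  ext q
  rw [← hE, ← hE]; exact H q q.2

open Nat in
theorem sum_permEnum {N t : ℕ} (ht : t < N !) (f : ℕ → ℕ) :
    ∑ q ∈ Finset.range N, f (permEnum N t q) = ∑ u ∈ Finset.range N, f u := by
  obtain ⟨E, hE⟩ := exists_permEnum_equiv N
  rw [Finset.sum_range, Finset.sum_range]
  simp_rw [fun q => hE ⟨t, ht⟩ q]
  exact Equiv.sum_comp (E ⟨t, ht⟩) (fun u => f u)

/-- The number of blocks of level `k`. -/
def blockCount (p : ℕ) : ℕ → ℕ
  | 0 => p
  | k + 1 => (blockCount p k).factorial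

/-- The number of extra copies of the block `0` of level `k` in a block of level `k + 1`. -/
def blockReps (p k : ℕ) : ℕ := blockCount p k / 2 ^ (k + 3)

/-- The length of the blocks of level `k`. -/
def blockLen (p : ℕ) : ℕ → ℕ
  | 0 => 1
  | k + 1 => (blockReps p k + blockCount p k) * blockLen p k

/-- The index of the `q`-th block of level `k` in the block `t` of level `k + 1`. -/
noncomputable def blockChild (p k t q : ℕ) : ℕ :=
  if q < blockReps p k then 0 else permEnum (blockCount p k) t (q - blockReps p k)

/-- The `i`-th letter of the block `t` of level `k`. -/
noncomputable def block (p : ℕ) [NeZero p] : ℕ → ℕ → ℕ → Fin p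
  | 0, t, _ => Fin.ofNat p t
  | k + 1, t, i => block p k (blockChild p k t (i / blockLen p k)) (i % blockLen p k)

/-- The sequence that starts with the block `0` of every level. -/
noncomputable def blockLimit (p : ℕ) [NeZero p] (i : ℕ) : Fin p := block p i 0 i

section Blocks

variable {p : ℕ} (hp : 2 ^ 12 ≤ p)

-- Since `n ^ 2 ≤ n !` for `n ≥ 4`, the exponent of 2 at least doubles from level to level.
include hp in
theorem le_blockCount (k : ℕ) : 2 ^ (12 * 2 ^ k) ≤ blockCount p k := by
  induction k with
  | zero => simpa [blockCount] using hp
  | succ k ih =>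
    have h4 : 4 ≤ blockCount p k := le_trans (by
      calc 4 = 2 ^ 2 := by norm_num
        _ ≤ 2 ^ (12 * 2 ^ k) := Nat.pow_le_pow_right (by norm_num)
            (by have := Nat.one_le_two_pow (n := k); omega)) ih
    have hsq : ∀ N : ℕ, 4 ≤ N → N ^ 2 ≤ N.factorial := by
      intro N hN
      induction N, hN using Nat.le_induction with
      | base => decide
      | succ N hN ih => rw [Nat.factorial_succ]; nlinarith
    calc 2 ^ (12 * 2 ^ (k + 1)) = (2 ^ (12 * 2 ^ k)) ^ 2 := by rw [← pow_mul]; congr 1; ring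
      _ ≤ blockCount p k ^ 2 := by gcongr
      _ ≤ _ := hsq _ h4

include hp in
theorem two_pow_le_blockCount (k : ℕ) : 2 ^ (4 * (k + 1)) ≤ blockCount p k := by
  refine le_trans (Nat.pow_le_pow_right (by norm_num) ?_) (le_blockCount hp k)
  have := Nat.lt_two_pow_self (n := k)
  omega

include hp in
theorem blockCount_pos (k : ℕ) : 0 < blockCount p k :=
  lt_of_lt_of_le (by positivity) (two_pow_le_blockCount hp k)

theorem blockReps_mul_le (p k : ℕ) : blockReps p k * 2 ^ (k + 3) ≤ blockCount p k :=
  Nat.div_mul_le_self _ _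

include hp in
theorem blockReps_pos (k : ℕ) : 0 < blockReps p k := by
  refine Nat.div_pos (le_trans (Nat.pow_le_pow_right (by norm_num) ?_)
    (two_pow_le_blockCount hp k)) (by positivity)
  omega

include hp in
theorem blockCount_le_blockReps_mul (k : ℕ) : blockCount p k ≤ blockReps p k * 2 ^ (k + 4) := by
  have h1 := blockReps_pos hp k
  have h2 : blockCount p k < 2 ^ (k + 3) * (blockReps p k + 1) :=
    Nat.lt_mul_div_succ _ (by positivity)
  have h3 : 2 ^ (k + 4) = 2 * 2 ^ (k + 3) := by ring
  nlinarith [Nat.zero_le (2 ^ (k + 3) * (blockReps p k - 1)), Nat.one_le_two_pow (n := k + 3)]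

include hp in
theorem two_pow_le_blockLen (k : ℕ) : 2 ^ (4 * k) ≤ blockLen p k := by
  cases k with
  | zero => simp [blockLen]
  | succ k =>
    have : 0 < blockLen p k := by
      induction k with
      | zero => simp [blockLen]
      | succ k ih => exact Nat.mul_pos (Nat.add_pos_right _ (blockCount_pos hp k)) ih
    have := two_pow_le_blockCount hp k
    simp only [blockLen]
    nlinarith [Nat.zero_le (blockReps p k)]

include hp in
theorem blockLen_pos (k : ℕ) : 0 < blockLen p k :=
  lt_of_lt_of_le (by positivity) (two_pow_le_blockLen hp k)

include hp in
theorem self_lt_blockLen (k : ℕ) : k < blockLen p k :=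
  lt_of_lt_of_le Nat.lt_two_pow_self
    (le_trans (Nat.pow_le_pow_right (by norm_num) (by omega)) (two_pow_le_blockLen hp k))

include hp in
theorem blockLen_mono : Monotone (blockLen p) := monotone_nat_of_le_succ fun k => by
  have := blockCount_pos hp k
  simp only [blockLen]
  nlinarith [Nat.zero_le (blockReps p k * blockLen p k)]

include hp in
theorem blockChild_lt {k t q : ℕ} (ht : t < blockCount p (k + 1))
    (hq : q < blockReps p k + blockCount p k) : blockChild p k t q < blockCount p k := by
  unfold blockChild
  split_ifs with h
  · exact blockCount_pos hp k
  · exact permEnum_lt ht (by omega)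

theorem exists_blockChild_eq {k t u : ℕ} (ht : t < blockCount p (k + 1))
    (hu : u < blockCount p k) :
    ∃ q < blockReps p k + blockCount p k, blockChild p k t q = u := by
  obtain ⟨q, hq, h⟩ := exists_permEnum_eq ht hu
  exact ⟨blockReps p k + q, by omega, by simp [blockChild, h]⟩

/-- The right-hand side does not depend on `t`, because a permutation only reorders the sum. This is
the source of unique ergodicity. -/
theorem sum_blockChild {k t : ℕ} (ht : t < blockCount p (k + 1)) (f : ℕ → ℕ) :
    ∑ q ∈ Finset.range (blockReps p k + blockCount p k), f (blockChild p k t q) =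
      blockReps p k * f 0 + ∑ u ∈ Finset.range (blockCount p k), f u := by
  rw [Finset.sum_range_add]
  congr 1
  · rw [Finset.sum_congr rfl (g := fun _ => f 0)]
    · simp
    · intro q hq; simp [blockChild, Finset.mem_range.1 hq]
  · rw [← sum_permEnum ht f]
    exact Finset.sum_congr rfl fun q _ => by simp [blockChild]

variable [NeZero p]

include hp in
theorem block_succ_mul_add (k t q : ℕ) {i : ℕ} (hi : i < blockLen p k) :
    block p (k + 1) t (q * blockLen p k + i) = block p k (blockChild p k t q) i := by
  have h := blockLen_pos hp k
  simp only [block]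
  rw [mul_comm q, Nat.mul_add_div h, Nat.div_eq_of_lt hi, Nat.mul_add_mod, Nat.mod_eq_of_lt hi,
    add_zero]

-- Different permutations differ at some child, and by induction those children differ as words.
-- Counting blocks thus counts words, as the entropy bound requires.
include hp in
theorem exists_block_ne {k t t' : ℕ} (ht : t < blockCount p k) (ht' : t' < blockCount p k)
    (h : t ≠ t') : ∃ i < blockLen p k, block p k t i ≠ block p k t' i := by
  induction k generalizing t t' with
  | zero =>
    refine ⟨0, by simp [blockLen], fun H => h ?_⟩
    have := congrArg Fin.val H
    simpa [block, Fin.ofNat, Nat.mod_eq_of_lt (show t < p from ht),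
      Nat.mod_eq_of_lt (show t' < p from ht')] using this
  | succ k ih =>
    obtain ⟨q, hq, hne⟩ := exists_permEnum_ne ht ht' h
    obtain ⟨i, hi, hb⟩ := ih (permEnum_lt ht hq) (permEnum_lt ht' hq) hne
    refine ⟨(blockReps p k + q) * blockLen p k + i, ?_, ?_⟩
    · simp only [blockLen]; nlinarith
    · rw [block_succ_mul_add hp _ _ _ hi, block_succ_mul_add hp _ _ _ hi]
      simpa [blockChild] using hb

-- The run is nonempty, so the block `0` of each level begins with the block `0` of the level below;
-- this makes the prefixes of the limit sequence consistent.
include hp in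
theorem block_zero_of_le {k K i : ℕ} (h : k ≤ K) (hi : i < blockLen p k) :
    block p K 0 i = block p k 0 i := by
  induction K, h using Nat.le_induction with
  | base => rfl
  | succ K hK ih =>
    have := block_succ_mul_add hp K 0 0 (hi.trans_le (blockLen_mono hp hK))
    rw [zero_mul, zero_add] at this
    rw [this, ← ih]
    simp [blockChild, blockReps_pos hp K]

include hp in
theorem blockLimit_eq {k i : ℕ} (hi : i < blockLen p k) : blockLimit p i = block p k 0 i := by
  rcases le_total k i with h | h
  · exact block_zero_of_le hp h hi
  · exact (block_zero_of_le hp h (self_lt_blockLen hp i)).symm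

include hp in
/-- The sequence `blockLimit p` is a concatenation of blocks of level `k`. -/
theorem exists_blockLimit_eq (k j : ℕ) :
    ∃ u < blockCount p k, ∀ i < blockLen p k,
      blockLimit p (j * blockLen p k + i) = block p k u i := by
  induction j using Nat.strong_induction_on generalizing k with
  | _ j ih =>
    rcases Nat.eq_zero_or_pos j with rfl | hj
    · exact ⟨0, blockCount_pos hp k, fun i hi => by
        rw [zero_mul, zero_add]; exact blockLimit_eq hp hi⟩
    · set Q := blockReps p k + blockCount p k with hQ
      have hQ2 : 2 ≤ Q := by have := blockCount_pos hp k; have := blockReps_pos hp k; omega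
      -- The induction is on the position with the level free: the parent of the `j`-th block has
      -- index `j / Q < j`, one level up.
      obtain ⟨u, hu, h⟩ := ih (j / Q) (Nat.div_lt_self hj hQ2) (k + 1)
      have hlt : j % Q < Q := Nat.mod_lt _ (by omega)
      refine ⟨blockChild p k u (j % Q), blockChild_lt hp hu hlt, fun i hi => ?_⟩
      rw [← block_succ_mul_add hp _ _ _ hi, ← h]
      · congr 1
        conv_lhs => rw [← Nat.div_add_mod j Q]
        simp only [blockLen, ← hQ]; ring
      · simp only [blockLen, ← hQ]; nlinarith

include hp in
/-- Refinement of `exists_blockLimit_eq`: blocks of two consecutive levels. -/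
theorem exists_blockLimit_eq_blockChild (k j : ℕ) :
    ∃ u < blockCount p (k + 1), ∀ q < blockReps p k + blockCount p k, ∀ i < blockLen p k,
      blockLimit p (j * blockLen p (k + 1) + (q * blockLen p k + i)) =
        block p k (blockChild p k u q) i := by
  obtain ⟨u, hu, h⟩ := exists_blockLimit_eq hp (k + 1) j
  refine ⟨u, hu, fun q hq i hi => ?_⟩
  rw [h, block_succ_mul_add hp _ _ _ hi]
  simp only [blockLen]; nlinarith

end Blocks

/-! ### Counting in aligned and arbitrary windows -/

theorem Nat.count_add_mul (P : ℕ → Prop) [DecidablePred P] (s L Q : ℕ) :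
    Nat.count P (s + Q * L) = Nat.count P s +
      ∑ q ∈ Finset.range Q, Nat.count (fun i => P (s + (q * L + i))) L := by
  induction Q with
  | zero => simp
  | succ Q ih =>
    rw [Finset.sum_range_succ, ← add_assoc, ← ih, Nat.succ_mul, ← add_assoc, Nat.count_add]
    simp only [add_assoc]

theorem Nat.exists_mul_le_lt_succ_mul (s : ℕ) {L : ℕ} (hL : 0 < L) :
    ∃ J, J * L ≤ s ∧ s < (J + 1) * L :=
  ⟨s / L, Nat.div_mul_le_self s L, by rw [mul_comm]; exact Nat.lt_mul_div_succ s hL⟩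

/-- If the numbers of `i` with `P i` in the intervals `[j * L, (j + 1) * L)` differ little, then so
do those in all long intervals. -/
theorem Nat.count_window_bounds (P : ℕ → Prop) [DecidablePred P] {L lo hi : ℕ} (hL : 0 < L)
    (h : ∀ j, lo ≤ Nat.count (fun i => P (j * L + i)) L ∧
      Nat.count (fun i => P (j * L + i)) L ≤ hi) (M s : ℕ) :
    (M - 1) * lo ≤ Nat.count (fun i => P (s + i)) (M * L) ∧
      Nat.count (fun i => P (s + i)) (M * L) ≤ (M + 1) * hi := by
  have key : ∀ j Q, Q * lo + Nat.count P (j * L) ≤ Nat.count P (j * L + Q * L) ∧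
      Nat.count P (j * L + Q * L) ≤ Q * hi + Nat.count P (j * L) := by
    intro j Q
    rw [Nat.count_add_mul]
    have h' : ∀ q, lo ≤ Nat.count (fun i => P (j * L + (q * L + i))) L ∧
        Nat.count (fun i => P (j * L + (q * L + i))) L ≤ hi := fun q => by
      simpa only [← add_assoc, ← add_mul] using h (j + q)
    have h1 := Finset.card_nsmul_le_sum (Finset.range Q) _ lo (fun q _ => (h' q).1)
    have h2 := Finset.sum_le_card_nsmul (Finset.range Q) _ hi (fun q _ => (h' q).2)
    simp only [Finset.card_range, smul_eq_mul] at h1 h2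
    omega
  have hadd := Nat.count_add P s (M * L)
  -- A window of length `M * L` contains `M - 1` consecutive aligned intervals and is covered by `M
  -- + 1` of them.
  obtain ⟨J, hJ1, hJ2⟩ := Nat.exists_mul_le_lt_succ_mul s hL
  constructor
  · rcases Nat.eq_zero_or_pos M with rfl | hM
    · simp
    have h1 := (key (J + 1) (M - 1)).1
    have h2 : Nat.count P s ≤ Nat.count P ((J + 1) * L) :=
      Nat.count_monotone P (by nlinarith)
    have h3 : Nat.count P ((J + 1) * L + (M - 1) * L) ≤ Nat.count P (s + M * L) := by
      refine Nat.count_monotone P ?_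
      obtain ⟨M', rfl⟩ : ∃ M', M = M' + 1 := ⟨M - 1, by omega⟩
      simp only [Nat.add_sub_cancel]; nlinarith
    omega
  · have h1 := (key J (M + 1)).2
    have h2 : Nat.count P (J * L) ≤ Nat.count P s := Nat.count_monotone P (by nlinarith)
    have h3 : Nat.count P (s + M * L) ≤ Nat.count P (J * L + (M + 1) * L) :=
      Nat.count_monotone P (by nlinarith)
    omega

/-! ### Occurrences of words in the limit sequence -/

section Occurrences

variable {p : ℕ} [NeZero p] (hp : 2 ^ 12 ≤ p)

/-- The number of occurrences of the word `w 0, …, w (ℓ - 1)` inside the block `u` of level `k`. -/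
noncomputable def blockOccurrences (w : ℕ → Fin p) (ℓ k u : ℕ) : ℕ :=
  Nat.count (fun i => i + ℓ ≤ blockLen p k ∧ ∀ j < ℓ, block p k u (i + j) = w j) (blockLen p k)

theorem blockOccurrences_le_blockLen (w : ℕ → Fin p) (ℓ k u : ℕ) :
    blockOccurrences w ℓ k u ≤ blockLen p k := Nat.count_le _

/-- Only occurrences starting in the last `ℓ` positions can cross the end of the block, whence the
error `ℓ`. -/
theorem count_occurrences_bounds {x : ℕ → Fin p} (w : ℕ → Fin p) (ℓ : ℕ) {k u s : ℕ}
    (h : ∀ i < blockLen p k, x (s + i) = block p k u i) :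
    blockOccurrences w ℓ k u ≤ Nat.count (fun i => ∀ j < ℓ, x (s + i + j) = w j) (blockLen p k) ∧
      Nat.count (fun i => ∀ j < ℓ, x (s + i + j) = w j) (blockLen p k) ≤
        blockOccurrences w ℓ k u + ℓ := by
  simp only [blockOccurrences, Nat.count_eq_card_filter_range]
  constructor
  · refine Finset.card_le_card fun i hi => ?_
    simp only [Finset.mem_filter, Finset.mem_range] at hi ⊢
    exact ⟨hi.1, fun j hj => by rw [add_assoc, h _ (by omega)]; exact hi.2.2 j hj⟩
  · refine le_trans (Finset.card_le_card (t := _ ∪ Finset.Ico (blockLen p k - ℓ) (blockLen p k))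
      fun i hi => ?_) ((Finset.card_union_le _ _).trans (Nat.add_le_add_left ?_ _))
    · simp only [Finset.mem_filter, Finset.mem_range, Finset.mem_union, Finset.mem_Ico] at hi ⊢
      by_cases hl : i + ℓ ≤ blockLen p k
      · exact Or.inl ⟨hi.1, hl, fun j hj => by rw [← h _ (by omega), ← add_assoc]; exact hi.2 j hj⟩
      · right; omega
    · rw [Nat.card_Ico]; omega

include hp in
/-- Occurrences of a fixed word have almost the same frequency in all long windows of
`blockLimit p`. -/
theorem exists_window_count_bounds (w : ℕ → Fin p) (ℓ k : ℕ) :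
    ∃ n lo hi : ℕ, 0 < n ∧
      (∀ s, lo ≤ Nat.count (fun i => ∀ j < ℓ, blockLimit p (s + i + j) = w j) n ∧
        Nat.count (fun i => ∀ j < ℓ, blockLimit p (s + i + j) = w j) n ≤ hi) ∧
      hi * blockLen p k ≤ lo * blockLen p k + (2 * ℓ + 2) * n := by
  set Q := blockReps p k + blockCount p k with hQ
  set S := blockReps p k * blockOccurrences w ℓ k 0 +
    ∑ u ∈ Finset.range (blockCount p k), blockOccurrences w ℓ k u with hS
  have hlen : blockLen p (k + 1) = Q * blockLen p k := rfl
  have hSL : S ≤ blockLen p (k + 1) := by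
    have h2 := Finset.sum_le_card_nsmul (Finset.range (blockCount p k)) _ (blockLen p k)
      (fun u _ => blockOccurrences_le_blockLen w ℓ k u)
    have h3 := blockOccurrences_le_blockLen w ℓ k 0
    simp only [Finset.card_range, smul_eq_mul] at h2
    rw [hlen, hQ, hS, add_mul]
    exact Nat.add_le_add (Nat.mul_le_mul_left _ h3) h2
  have hL := blockLen_pos hp k
  have hL' := blockLen_pos hp (k + 1)
  have hj : ∀ j, S ≤ Nat.count (fun i => ∀ e < ℓ,
        blockLimit p (j * blockLen p (k + 1) + i + e) = w e) (blockLen p (k + 1)) ∧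
      Nat.count (fun i => ∀ e < ℓ, blockLimit p (j * blockLen p (k + 1) + i + e) = w e)
        (blockLen p (k + 1)) ≤ S + ℓ * Q := by
    intro j
    obtain ⟨u, hu, h⟩ := exists_blockLimit_eq_blockChild hp k j
    have hc := Nat.count_add_mul (fun i => ∀ e < ℓ,
      blockLimit p (j * blockLen p (k + 1) + i + e) = w e) 0 (blockLen p k) Q
    simp only [zero_add, Nat.count_zero] at hc
    rw [show blockLen p (k + 1) = Q * blockLen p k from rfl] at hc ⊢
    rw [hc]
    have hb : ∀ q ∈ Finset.range Q, _ := fun q hq =>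
      count_occurrences_bounds (x := blockLimit p) (s := j * (Q * blockLen p k) + q * blockLen p k)
        (u := blockChild p k u q) w ℓ
        (fun i hi => by rw [add_assoc]; exact h q (Finset.mem_range.1 hq) i hi)
    simp only [add_assoc] at hb ⊢
    rw [hS, ← sum_blockChild hu]
    refine ⟨Finset.sum_le_sum fun q hq => (hb q hq).1, ?_⟩
    refine (Finset.sum_le_sum fun q hq => (hb q hq).2).trans_eq ?_
    rw [Finset.sum_add_distrib]
    simp [hQ, mul_comm]
  -- Windows of `blockLen p k` aligned intervals have length `n = blockLen p k * blockLen p (k +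
  -- 1)`. The boundary intervals cost `2 * S` and the words crossing the ends of children at most
  -- `(blockLen p k + 1) * ℓ * Q`; multiplied by `blockLen p k` these are at most `2 * n` and `2 * ℓ
  -- * n`.
  have hwin := Nat.count_window_bounds
    (fun i => ∀ e < ℓ, blockLimit p (i + e) = w e) hL' hj (blockLen p k)
  refine ⟨_, _, _, Nat.mul_pos hL hL', hwin, ?_⟩
  obtain ⟨M, hM⟩ : ∃ M, blockLen p k = M + 1 := ⟨blockLen p k - 1, by omega⟩
  rw [hM] at hlen ⊢
  simp only [Nat.add_sub_cancel]
  have e1 : ℓ * Q * (M + 1) = ℓ * blockLen p (k + 1) := by rw [hlen]; ring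
  nlinarith [Nat.mul_le_mul_left (M + 1) hSL, Nat.zero_le (ℓ * blockLen p (k + 1) * M)]

include hp in
/-- Long powers of the block `0` of level `k` are frequent in `blockLimit p`. -/
theorem blockReps_le_two_mul_count {k m : ℕ} (hm : 2 * m ≤ blockReps p k * blockLen p k) (s : ℕ) :
    blockReps p k ≤ 2 * Nat.count (fun i => ∀ j < m,
      blockLimit p (s + i + j) = block p k 0 (j % blockLen p k)) (2 * blockLen p (k + 1)) := by
  have hL := blockLen_pos hp k
  have hL' := blockLen_pos hp (k + 1)
  set r := blockReps p k with hr
  set L := blockLen p k with hLdef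
  set L' := blockLen p (k + 1) with hLdef'
  have hrL : r * L ≤ L' := Nat.mul_le_mul_right _ (Nat.le_add_right _ _)
  obtain ⟨J, hJ1, hJ2⟩ := Nat.exists_mul_le_lt_succ_mul s hL'
  obtain ⟨u, -, h⟩ := exists_blockLimit_eq_blockChild hp k (J + 1)
  rw [← hLdef'] at h
  obtain ⟨o, ho⟩ : ∃ o, (J + 1) * L' = s + o := ⟨(J + 1) * L' - s, by
    have : s ≤ (J + 1) * L' := by nlinarith
    omega⟩
  have hoL : o ≤ L' := by nlinarith
  -- The word fills at most half of the run, so it can be read from the start of each child `q ≤ r /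
  -- 2` without leaving the run.
  have hcard : r / 2 + 1 ≤ Nat.count (fun i => ∀ j < m,
      blockLimit p (s + i + j) = block p k 0 (j % L)) (2 * L') := by
    rw [Nat.count_eq_card_filter_range, ← Finset.card_range (r / 2 + 1)]
    refine Finset.card_le_card_of_injOn (fun q => o + q * L) ?_ ?_
    · intro q hq
      have hq : q < r / 2 + 1 := by simpa using hq
      have hq2 : 2 * q ≤ r := by omega
      have hqm : q * L + m ≤ r * L := by nlinarith
      have hqr : q < r := by have := blockReps_pos hp k; omega
      simp only [Finset.coe_filter, Finset.mem_range, mem_ofPred_eq]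
      refine ⟨by nlinarith, fun j hj => ?_⟩
      have hjL := Nat.div_add_mod j L
      have hjm := Nat.mod_lt j hL
      have hqj : q + j / L < r := by
        by_contra! hcon
        have h1 := Nat.mul_le_mul_right L hcon
        rw [add_mul, mul_comm (j / L)] at h1
        omega
      have := h (q + j / L) (by omega) (j % L) hjm
      rw [show blockChild p k u (q + j / L) = 0 from by simp [blockChild, ← hr, hqj]] at this
      rw [← this, ho]
      congr 1
      nlinarith
    · intro q _ q' _ hqq
      have : o + q * L = o + q' * L := hqq
      exact Nat.eq_of_mul_eq_mul_right hL (by omega)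
  omega

include hp in
/-- Every prefix of `blockLimit p` occurs in every long window of `blockLimit p`. -/
theorem exists_prefix_occurrence (n : ℕ) (s : ℕ) : ∃ W, ∀ s', ∃ o ≤ W,
    ∀ i < n, blockLimit p (s' + o + i) = blockLimit p (s + i) := by
  have hsn := self_lt_blockLen hp (s + n)
  set k := s + n
  -- One length to reach an aligned block of level `k + 1`, one to reach a child `0` inside it, and
  -- one for the offset `s` within that child.
  refine ⟨3 * blockLen p (k + 1), fun s' => ?_⟩
  have hL' := blockLen_pos hp (k + 1)
  set L' := blockLen p (k + 1) with hLdef'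
  obtain ⟨J, hJ1, hJ2⟩ := Nat.exists_mul_le_lt_succ_mul s' hL'
  obtain ⟨u, hu, h⟩ := exists_blockLimit_eq_blockChild hp k (J + 1)
  rw [← hLdef'] at h
  obtain ⟨q, hq, hq0⟩ := exists_blockChild_eq hu (blockCount_pos hp k)
  have hqL : q * blockLen p k ≤ L' := Nat.mul_le_mul_right _ hq.le
  have hkL : blockLen p k ≤ L' := blockLen_mono hp (Nat.le_succ k)
  refine ⟨(J + 1) * L' - s' + q * blockLen p k + s, ?_, fun i hi => ?_⟩
  · have : (J + 1) * L' ≤ s' + L' := by nlinarith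
    omega
  · have h2 := h q hq (s + i) (by omega)
    rw [hq0, ← blockLimit_eq hp (show s + i < blockLen p k by omega)] at h2
    rw [← h2]
    congr 1
    omega

include hp in
/-- Every block occurs in `blockLimit p`. -/
theorem exists_block_occurrence {k t : ℕ} (ht : t < blockCount p k) :
    ∃ s, ∀ i < blockLen p k, blockLimit p (s + i) = block p k t i := by
  obtain ⟨u, hu, h⟩ := exists_blockLimit_eq_blockChild hp k 0
  obtain ⟨q, hq, rfl⟩ := exists_blockChild_eq hu ht
  exact ⟨q * blockLen p k, fun i hi => by simpa using h q hq i hi⟩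

end Occurrences

/-! ### Exponential growth of the number of blocks -/

section Growth

variable {p : ℕ} (hp : 2 ^ 12 ≤ p)

-- The exponent 12 in the bound on `p` is chosen so that `12 * log 2 > 8`.
include hp in
theorem two_pow_le_log_blockCount (k : ℕ) : (2 : ℝ) ^ (k + 3) ≤ Real.log (blockCount p k) := by
  have h : ((2 ^ (12 * 2 ^ k) : ℕ) : ℝ) ≤ blockCount p k := by exact_mod_cast le_blockCount hp k
  have h2 := Real.log_le_log (by positivity) h
  rw [Nat.cast_pow, Real.log_pow] at h2
  have := Real.log_two_gt_d9
  have h3 : (0 : ℝ) < 2 ^ k := by positivity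
  push_cast at h2
  rw [pow_add]
  nlinarith

theorem mul_log_sub_self_le_log_factorial {n : ℕ} (hn : 0 < n) :
    n * Real.log n - n ≤ Real.log n.factorial := by
  have h := Real.pow_div_factorial_le_exp n (by positivity) n
  have hf : (0 : ℝ) < n.factorial := by exact_mod_cast n.factorial_pos
  have hn' : (0 : ℝ) < n := by exact_mod_cast hn
  have := Real.log_le_log (by positivity) h
  rw [Real.log_exp, Real.log_div (by positivity) (by positivity), Real.log_pow] at this
  linarith

-- The factor `1 + d`, with `d = 2 ^ -k`, is slack that makes the induction close. One step loses a
-- factor `1 + d / 8` in length to the run and a factor `1 - d / 8` to the term `-N` in Stirling's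
-- bound, and `(1 + d / 2) * (1 + d / 8) ≤ (1 - d / 8) * (1 + d)` for `d ≤ 1`.
include hp in
theorem mul_blockLen_le_log_blockCount (k : ℕ) :
    (1 + (1 / 2) ^ k) * (blockLen p k : ℝ) ≤ Real.log (blockCount p k) := by
  induction k with
  | zero =>
    have := two_pow_le_log_blockCount hp 0
    norm_num [blockLen] at this ⊢
    linarith
  | succ k ih =>
    have h1 := mul_log_sub_self_le_log_factorial (blockCount_pos hp k)
    have h2 := two_pow_le_log_blockCount hp k
    have h3 : (blockReps p k : ℝ) * 2 ^ (k + 3) ≤ blockCount p k := by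
      exact_mod_cast blockReps_mul_le p k
    have hN : (0 : ℝ) < blockCount p k := by exact_mod_cast blockCount_pos hp k
    have hL : (0 : ℝ) < blockLen p k := by exact_mod_cast blockLen_pos hp k
    set N : ℝ := (blockCount p k : ℝ) with hNdef
    set L : ℝ := (blockLen p k : ℝ) with hLdef
    set r : ℝ := (blockReps p k : ℝ) with hrdef
    set d : ℝ := (1 / 2) ^ k with hd
    have hd0 : 0 < d := by positivity
    have hd1 : d ≤ 1 := pow_le_one₀ (by norm_num) (by norm_num)
    have hdk : d * 2 ^ (k + 3) = 8 := by
      rw [hd, pow_add, ← mul_assoc, ← mul_pow]; norm_num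
    have hr : r ≤ N * (d / 8) := by nlinarith
    have hlog : N ≤ N * (d / 8 * Real.log N) := by
      have : 1 ≤ d / 8 * Real.log N := by nlinarith
      nlinarith
    have hcast : (blockLen p (k + 1) : ℝ) = (r + N) * L := by
      simp only [blockLen]; push_cast; rfl
    change _ ≤ Real.log ((blockCount p k).factorial : ℝ)
    refine le_trans ?_ h1
    rw [hcast, pow_succ, ← hd]
    calc (1 + d * (1 / 2)) * ((r + N) * L) ≤ (1 + d * (1 / 2)) * ((N * (d / 8) + N) * L) := by
          gcongr
      _ = N * L * ((1 + d / 2) * (1 + d / 8)) := by ring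
      _ ≤ N * L * ((1 - d / 8) * (1 + d)) :=
          mul_le_mul_of_nonneg_left (by nlinarith) (by positivity)
      _ = N * (1 - d / 8) * ((1 + d) * L) := by ring
      _ ≤ N * (1 - d / 8) * Real.log N := by
          gcongr
          exact mul_nonneg hN.le (by linarith)
      _ ≤ N * Real.log N - N := by nlinarith

include hp in
/-- The number of blocks is exponential in their length. -/
theorem exp_blockLen_le_blockCount (k : ℕ) : Real.exp (blockLen p k) ≤ blockCount p k := by
  have h := mul_blockLen_le_log_blockCount hp k
  have hN : (0 : ℝ) < blockCount p k := by exact_mod_cast blockCount_pos hp k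
  rw [← Real.le_log_iff_exp_le hN]
  refine le_trans ?_ h
  have : (0 : ℝ) ≤ (1 / 2) ^ k * (blockLen p k : ℝ) := by positivity
  linarith

end Growth

/-! ### Vanishing correlation entropy from frequent visits -/

/-- A sequence in `[0, 1]` that decays subexponentially. -/
theorem tendsto_neg_log_div_zero {f : ℕ → ℝ≥0∞} (h1 : ∀ m, f m ≤ 1)
    (h : ∀ η : ℝ, 0 < η → ∀ᶠ m : ℕ in atTop, ENNReal.ofReal (Real.exp (-(η * m))) ≤ f m) :
    Tendsto (fun m : ℕ => -ENNReal.log (f m) / (m : EReal)) atTop (𝓝 0) := by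
  have hnn : ∀ m : ℕ, 0 ≤ -ENNReal.log (f m) / (m : EReal) := fun m => by
    refine EReal.div_nonneg ?_ (by exact_mod_cast Nat.zero_le m)
    rw [EReal.neg_nonneg]
    exact (ENNReal.log_le_log (h1 m)).trans_eq ENNReal.log_one
  refine tendsto_order.2 ⟨fun a ha => Eventually.of_forall fun m => ha.trans_le (hnn m), ?_⟩
  intro a ha
  obtain ⟨η, hη0, hηa⟩ := EReal.lt_iff_exists_real_btwn.1 ha
  have hη : 0 < η := by exact_mod_cast hη0
  filter_upwards [h η hη, eventually_gt_atTop 0] with m hm hm0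
  refine lt_of_le_of_lt ?_ hηa
  have hlog := ENNReal.log_le_log hm
  rw [ENNReal.log_ofReal_of_pos (Real.exp_pos _), Real.log_exp] at hlog
  rw [EReal.div_le_iff_le_mul (by exact_mod_cast hm0) (EReal.natCast_ne_top m), EReal.neg_le]
  refine le_trans (le_of_eq ?_) hlog
  have : (m : EReal) = ((m : ℝ) : EReal) := rfl
  rw [this, ← EReal.coe_mul, ← EReal.coe_neg, mul_comm]

section General

variable {X : Type*} [PseudoMetricSpace X]

theorem correlationSum_le_one (f : X → X) (m : ℕ) (x : X) (n : ℕ) (ε : ℝ) :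
    correlationSum f m x n ε ≤ 1 := by
  refine ENNReal.div_le_of_le_mul ?_
  rw [one_mul]
  have hsub : {q : ℕ × ℕ | q.1 < n ∧ q.2 < n ∧ bowenDist f m (f^[q.1] x) (f^[q.2] x) ≤ ε} ⊆
      ((Finset.range n ×ˢ Finset.range n : Finset (ℕ × ℕ)) : Set (ℕ × ℕ)) := by
    rintro q ⟨h1, h2, -⟩
    simp [h1, h2]
  have := Set.ncard_le_ncard hsub (Finset.finite_toSet _)
  rw [Set.ncard_coe_finset, Finset.card_product, Finset.card_range, ← sq] at this
  exact_mod_cast this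

/-- If a set of small Bowen diameter is visited at least `R` times in every `W` steps, then the
correlation sums are bounded below. -/
theorem eventually_le_correlationSum {f : X → X} {m : ℕ} {ε : ℝ} {V : Set X}
    (hV : ∀ y ∈ V, ∀ z ∈ V, bowenDist f m y z ≤ ε) [DecidablePred (· ∈ V)] {R W : ℕ}
    (hW : 0 < W) (hR : ∀ y, R ≤ Nat.count (fun i => f^[i] y ∈ V) W) (x : X) :
    ∀ᶠ n in atTop, ENNReal.ofReal ((R / (2 * W)) ^ 2) ≤ correlationSum f m x n ε := by
  filter_upwards [eventually_ge_atTop W] with n hn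
  have hn0 : 0 < n := hW.trans_le hn
  set c := Nat.count (fun i => f^[i] x ∈ V) n with hc
  have hcount : n / W * R ≤ c := by
    refine le_trans ?_ (Nat.count_monotone _ (Nat.div_mul_le_self n W))
    have := Nat.count_add_mul (fun i => f^[i] x ∈ V) 0 W (n / W)
    simp only [zero_add, Nat.count_zero] at this
    rw [this, ← Finset.card_range (n / W), ← smul_eq_mul, Finset.card_range]
    have h2 := Finset.card_nsmul_le_sum (Finset.range (n / W))
      (fun q => Nat.count (fun i => f^[q * W + i] x ∈ V) W) R fun q _ => by
        have := hR (f^[q * W] x)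
        simpa only [← Function.iterate_add_apply, add_comm] using this
    simpa using h2
  -- Rounding `n` down to a multiple of `W` loses at most half; this is the 2 in `R / (2 * W)`.
  have hnW : n ≤ n / W * (2 * W) := by
    have h1 : n < W * (n / W + 1) := Nat.lt_mul_div_succ n hW
    have h2 : 1 ≤ n / W := (Nat.one_le_div_iff hW).2 hn
    nlinarith
  have hcR : n * R ≤ c * (2 * W) := by
    calc n * R ≤ n / W * (2 * W) * R := Nat.mul_le_mul_right _ hnW
      _ = n / W * R * (2 * W) := by ring
      _ ≤ _ := Nat.mul_le_mul_right _ hcount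
  have hcard : c ^ 2 ≤ Set.ncard {q : ℕ × ℕ | q.1 < n ∧ q.2 < n ∧
      bowenDist f m (f^[q.1] x) (f^[q.2] x) ≤ ε} := by
    set A := (Finset.range n).filter (fun i => f^[i] x ∈ V) with hA
    have hAc : A.card = c := by rw [hc, Nat.count_eq_card_filter_range]
    rw [sq, ← hAc, ← Finset.card_product, ← Set.ncard_coe_finset]
    refine Set.ncard_le_ncard ?_ ?_
    · intro q hq
      simp only [hA, Finset.coe_product, Finset.coe_filter, Finset.mem_range, Set.mem_prod,
        mem_ofPred_eq] at hq
      exact ⟨hq.1.1, hq.2.1, hV _ hq.1.2 _ hq.2.2⟩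
    · refine ((Finset.range n ×ˢ Finset.range n).finite_toSet).subset ?_
      rintro q ⟨h1, h2, -⟩
      simp [h1, h2]
  have hn2 : ((n : ℝ≥0∞)) ^ 2 ≠ 0 := by simp [hn0.ne']
  have hn3 : ((n : ℝ≥0∞)) ^ 2 ≠ ⊤ := by simp
  rw [correlationSum, ENNReal.le_div_iff_mul_le (Or.inl hn2) (Or.inl hn3)]
  refine le_trans ?_ (Nat.cast_le.2 hcard)
  have e1 : ((n : ℝ≥0∞)) ^ 2 = ENNReal.ofReal ((n : ℝ) ^ 2) := by
    rw [ENNReal.ofReal_pow (by positivity), ENNReal.ofReal_natCast]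
  have e2 : ((c ^ 2 : ℕ) : ℝ≥0∞) = ENNReal.ofReal ((c : ℝ) ^ 2) := by
    rw [ENNReal.ofReal_pow (by positivity), ENNReal.ofReal_natCast, Nat.cast_pow]
  rw [e1, e2, ← ENNReal.ofReal_mul (by positivity), ← mul_pow]
  refine ENNReal.ofReal_le_ofReal (pow_le_pow_left₀ (by positivity) ?_ 2)
  have hW' : (0 : ℝ) < W := by exact_mod_cast hW
  rw [div_mul_eq_mul_div, div_le_iff₀ (by positivity), mul_comm (R : ℝ)]
  exact_mod_cast hcR

/-- Visits to a set, counted along orbit segments, integrate to a multiple of its measure. -/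
theorem MeasureTheory.MeasurePreserving.count_bounds {Y : Type*} [MeasurableSpace Y] {T : Y → Y}
    {μ : Measure Y} [IsProbabilityMeasure μ] (hT : MeasurePreserving T μ μ) {V : Set Y}
    (hV : MeasurableSet V) [DecidablePred (· ∈ V)] {n lo hi : ℕ}
    (h : ∀ y, lo ≤ Nat.count (fun i => T^[i] y ∈ V) n ∧ Nat.count (fun i => T^[i] y ∈ V) n ≤ hi) :
    (lo : ℝ≥0∞) ≤ n * μ V ∧ n * μ V ≤ hi := by
  have hint : ∫⁻ y, (Nat.count (fun i => T^[i] y ∈ V) n : ℝ≥0∞) ∂μ = n * μ V := by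
    have : ∀ y, (Nat.count (fun i => T^[i] y ∈ V) n : ℝ≥0∞) =
        ∑ i ∈ Finset.range n, (T^[i] ⁻¹' V).indicator 1 y := fun y => by
      rw [Nat.count_eq_card_filter_range, Finset.card_filter]
      push_cast
      exact Finset.sum_congr rfl fun i _ => by
        by_cases hi : T^[i] y ∈ V <;> simp [Set.indicator, hi]
    simp_rw [this]
    have hm : ∀ i, MeasurableSet (T^[i] ⁻¹' V) := fun i => (hT.iterate i).measurable hV
    rw [lintegral_finsetSum _ fun i _ => measurable_one.indicator (hm i)]
    simp_rw [lintegral_indicator_one (hm _),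
      fun i => (hT.iterate i).measure_preimage hV.nullMeasurableSet]
    simp
  rw [← hint]
  constructor
  · calc (lo : ℝ≥0∞) = ∫⁻ _, (lo : ℝ≥0∞) ∂μ := by simp
      _ ≤ _ := lintegral_mono fun y => Nat.cast_le.2 (h y).1
  · calc _ ≤ ∫⁻ _, (hi : ℝ≥0∞) ∂μ := lintegral_mono fun y => Nat.cast_le.2 (h y).2
      _ = hi := by simp

/-- Analogue of `eventually_le_correlationSum` for correlation integrals. -/
theorem le_correlationIntegral [MeasurableSpace X] {f : X → X} {μ : Measure X}
    [IsProbabilityMeasure μ] (hf : MeasurePreserving f μ μ) {m : ℕ} {ε : ℝ} {V : Set X}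
    (hVm : MeasurableSet V) (hV : ∀ y ∈ V, ∀ z ∈ V, bowenDist f m y z ≤ ε)
    [DecidablePred (· ∈ V)] {R W : ℕ}
    (hW : 0 < W) (hR : ∀ y, R ≤ Nat.count (fun i => f^[i] y ∈ V) W) :
    ENNReal.ofReal ((R / (2 * W)) ^ 2) ≤ correlationIntegral f m μ ε := by
  have h1 := (hf.count_bounds hVm (fun y => ⟨hR y, Nat.count_le _⟩)).1
  have h2 : μ V * μ V ≤ correlationIntegral f m μ ε := by
    rw [← Measure.prod_prod]
    exact measure_mono fun q hq => hV _ hq.1 _ hq.2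
  refine le_trans ?_ h2
  rw [← sq, ENNReal.ofReal_pow (by positivity)]
  gcongr
  have hW' : (0 : ℝ) < W := by exact_mod_cast hW
  -- The factor 2 is given away so that the bound has the same form as the one for correlation sums.
  calc ENNReal.ofReal (R / (2 * W)) ≤ ENNReal.ofReal (R / W) := by
        refine ENNReal.ofReal_le_ofReal ?_
        gcongr
        linarith
    _ = (R : ℝ≥0∞) / W := by
        rw [ENNReal.ofReal_div_of_pos hW', ENNReal.ofReal_natCast, ENNReal.ofReal_natCast]
    _ ≤ μ V := ENNReal.div_le_of_le_mul (by rwa [mul_comm])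

/-- A criterion for vanishing of all correlation entropies: for every `ε > 0` there are sets `V` of
Bowen `m`-diameter at most `ε` that are visited with frequencies subexponentially small in `m`. -/
theorem hasCorrelationEntropy_zero_of_frequent_sets [MeasurableSpace X] {f : X → X}
    (h : ∀ ε : ℝ, 0 < ε → ∀ η : ℝ, 0 < η → ∀ᶠ m : ℕ in atTop, ∃ (V : Set X) (R W : ℕ),
      MeasurableSet V ∧ (∀ y ∈ V, ∀ z ∈ V, bowenDist f m y z ≤ ε) ∧ 0 < W ∧
      (∀ [DecidablePred (· ∈ V)] (y : X), R ≤ Nat.count (fun i => f^[i] y ∈ V) W) ∧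
      Real.exp (-(η * m)) ≤ (R / (2 * W)) ^ 2) :
    (∀ x, HasLocalCorrelationEntropy f x 0) ∧
      ∀ μ : Measure X, IsInvariantProbability f μ → HasCorrelationEntropy f μ 0 := by
  classical
  have hconst : ∀ F : ℝ → EReal, (∀ ε, 0 < ε → F ε = 0) → Tendsto F (𝓝[>] 0) (𝓝 0) := by
    intro F hF
    refine tendsto_const_nhds.congr' ?_
    filter_upwards [self_mem_nhdsWithin] with ε hε using (hF ε hε).symm
  have hle : ∀ x m ε, lowerCorrelationSum f m x ε ≤ upperCorrelationSum f m x ε :=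
    fun x m ε => liminf_le_limsup
  have hupper : ∀ x m ε, upperCorrelationSum f m x ε ≤ 1 := fun x m ε =>
    limsup_le_of_le (by isBoundedDefault)
      (Eventually.of_forall fun n => correlationSum_le_one f m x n ε)
  constructor
  · intro x
    have hlower : ∀ ε : ℝ, 0 < ε → ∀ η : ℝ, 0 < η → ∀ᶠ m : ℕ in atTop,
        ENNReal.ofReal (Real.exp (-(η * m))) ≤ lowerCorrelationSum f m x ε := by
      intro ε hε η hη
      filter_upwards [h ε hε η hη] with m ⟨V, R, W, _, hV, hW, hR, hexp⟩
      refine le_trans (ENNReal.ofReal_le_ofReal hexp) ?_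
      exact le_liminf_of_le (by isBoundedDefault) (eventually_le_correlationSum hV hW hR x)
    refine ⟨hconst _ fun ε hε => ?_, hconst _ fun ε hε => ?_⟩
    · exact (tendsto_neg_log_div_zero (fun m => (hle x m ε).trans (hupper x m ε))
        (hlower ε hε)).limsup_eq
    · exact (tendsto_neg_log_div_zero (fun m => hupper x m ε) fun η hη =>
        (hlower ε hε η hη).mono fun m hm => hm.trans (hle x m ε)).liminf_eq
  · rintro μ ⟨hμ, hT⟩
    have key : ∀ ε : ℝ, 0 < ε → Tendsto (fun m : ℕ =>
        -ENNReal.log (correlationIntegral f m μ ε) / (m : EReal)) atTop (𝓝 0) := by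
      intro ε hε
      refine tendsto_neg_log_div_zero (fun m => prob_le_one) fun η hη => ?_
      filter_upwards [h ε hε η hη] with m ⟨V, R, W, hVm, hV, hW, hR, hexp⟩
      exact (ENNReal.ofReal_le_ofReal hexp).trans (le_correlationIntegral hT hVm hV hW hR)
    exact ⟨hconst _ fun ε hε => (key ε hε).limsup_eq, hconst _ fun ε hε => (key ε hε).liminf_eq⟩

end General

/-! ### Existence of invariant measures -/

/-- The Krylov–Bogoliubov theorem. -/
theorem exists_isInvariantProbability {Y : Type*} [TopologicalSpace Y] [MeasurableSpace Y]
    [CompactSpace Y] [T2Space Y] [BorelSpace Y] [HasOuterApproxClosed Y]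
    [Nonempty Y] {T : Y → Y} (hT : Continuous T) :
    ∃ μ : Measure Y, IsInvariantProbability T μ := by
  obtain ⟨x⟩ := ‹Nonempty Y›
  have hprob : ∀ n : ℕ, IsProbabilityMeasure
      ((n + 1 : ℝ≥0∞)⁻¹ • ∑ i ∈ Finset.range (n + 1), Measure.dirac (T^[i] x)) := by
    intro n
    constructor
    simp only [Measure.smul_apply, Measure.finsetSum_apply, measure_univ, Finset.sum_const,
      Finset.card_range, smul_eq_mul, nsmul_eq_mul, mul_one, Nat.cast_add, Nat.cast_one]
    exact ENNReal.inv_mul_cancel (by simp) (by finiteness)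
  let ν : ℕ → ProbabilityMeasure Y := fun n => ⟨_, hprob n⟩
  -- Weak compactness of the probability measures gives a limit of the orbit averages along an
  -- ultrafilter, with no need for subsequences.
  obtain ⟨μ, hμ⟩ : ∃ μ, Tendsto ν (Ultrafilter.of (atTop : Filter ℕ)) (𝓝 μ) := by
    obtain ⟨μ, -, hμ⟩ := isCompact_univ.ultrafilter_le_nhds
      ((Ultrafilter.of (atTop : Filter ℕ)).map ν) (by simp)
    exact ⟨μ, hμ⟩
  have hint : ∀ (n : ℕ) (g : BoundedContinuousFunction Y ℝ), ∫ y, g y ∂(ν n : Measure Y) =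
      (n + 1 : ℝ)⁻¹ * ∑ i ∈ Finset.range (n + 1), g (T^[i] x) := by
    intro n g
    change ∫ y, g y ∂((n + 1 : ℝ≥0∞)⁻¹ • ∑ i ∈ Finset.range (n + 1), Measure.dirac (T^[i] x)) = _
    rw [integral_smul_measure, integral_finsetSum_measure (fun i _ => g.integrable _)]
    simp [integral_dirac, ENNReal.toReal_add]
  have hmap : μ.map hT.measurable.aemeasurable = μ := by
    refine tendsto_nhds_unique
      ((ProbabilityMeasure.continuous_map hT).continuousAt.tendsto.comp hμ) ?_
    rw [ProbabilityMeasure.tendsto_iff_forall_integral_tendsto] at hμ ⊢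
    intro g
    -- The integrals of `g` against an average and its push-forward differ by a telescoping sum, of
    -- which only these end terms remain.
    have hzero : Tendsto (fun n : ℕ => (n + 1 : ℝ)⁻¹ * (g (T^[n + 1] x) - g x)) atTop (𝓝 0) := by
      have h1 : Tendsto (fun n : ℕ => (2 * ‖g‖) * ((1 : ℝ) / (n + 1))) atTop (𝓝 0) := by
        simpa using tendsto_one_div_add_atTop_nhds_zero_nat.const_mul (2 * ‖g‖)
      refine squeeze_zero_norm (fun n => ?_) h1
      rw [norm_mul, mul_comm, one_div, norm_inv,
        Real.norm_of_nonneg (by positivity : (0 : ℝ) ≤ n + 1)]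
      gcongr
      refine (norm_sub_le _ _).trans ?_
      linarith [g.norm_coe_le_norm (T^[n + 1] x), g.norm_coe_le_norm x]
    have hsum := (hμ g).add (hzero.mono_left (Ultrafilter.of_le atTop))
    rw [add_zero] at hsum
    refine hsum.congr fun n => ?_
    rw [hint]
    simp only [Function.comp, ProbabilityMeasure.toMeasure_map]
    rw [integral_map hT.measurable.aemeasurable g.continuous.aestronglyMeasurable]
    have := hint n (g.compContinuous ⟨T, hT⟩)
    simp only [BoundedContinuousFunction.compContinuous_apply, ContinuousMap.coe_mk] at this
    rw [this, ← mul_add]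
    congr 1
    simp_rw [← Function.iterate_succ_apply' T]
    rw [Finset.sum_range_succ' (fun i => g (T^[i] x)), Finset.sum_range_succ]
    simp
  refine ⟨μ, inferInstance, hT.measurable, ?_⟩
  exact congrArg (fun ρ : ProbabilityMeasure Y => (ρ : Measure Y)) hmap

/-! ### Dynamics of orbit closures -/

section OrbitClosure

variable {p : ℕ}

/-- The closure of the orbit of `a` under the shift. -/
def orbitClosure (a : ℕ → Fin p) : SymbolicDynamics.FullShift.Subshift (Fin p) ℕ where
  carrier := {x | ∀ n, ∃ s, ∀ i < n, x i = a (s + i)}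
  isClosed := by
    rw [← isSeqClosed_iff_isClosed]
    intro u x hu hx n
    have h : ∀ᶠ N in atTop, ∀ i < n, u N i = x i := by
      have : ∀ i ∈ Finset.range n, ∀ᶠ N in atTop, u N i = x i := fun i _ => by
        have := tendsto_pi_nhds.1 hx i
        rw [nhds_discrete, tendsto_pure] at this
        exact this
      filter_upwards [(Filter.eventually_all_finset _).2 this] with N hN i hi
      exact hN i (Finset.mem_range.2 hi)
    obtain ⟨N, hN⟩ := h.exists
    obtain ⟨s, hs⟩ := hu N n
    exact ⟨s, fun i hi => by rw [← hN i hi, hs i hi]⟩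
  mapsTo := by
    intro g x hx n
    obtain ⟨s, hs⟩ := hx (g + n)
    refine ⟨s + g, fun i hi => ?_⟩
    rw [SymbolicDynamics.FullShift.shift_apply, hs _ (by omega), add_assoc]

theorem shift_mem_orbitClosure (a : ℕ → Fin p) (s : ℕ) :
    (fun i => a (s + i)) ∈ (orbitClosure a).carrier := fun _ => ⟨s, fun _ _ => rfl⟩

theorem subshiftMap_iterate_apply (X : SymbolicDynamics.FullShift.Subshift (Fin p) ℕ) (n : ℕ)
    (x : X.carrier) (j : ℕ) : ((subshiftMap X)^[n] x).1 j = x.1 (n + j) := by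
  induction n generalizing x with
  | zero => simp
  | succ n ih =>
    rw [Function.iterate_succ_apply, ih]
    change x.1 (1 + (n + j)) = _
    exact congrArg x.1 (by omega)

theorem continuous_subshiftMap (X : SymbolicDynamics.FullShift.Subshift (Fin p) ℕ) :
    Continuous (subshiftMap X) :=
  (SymbolicDynamics.FullShift.continuous_shift 1).restrict (X.mapsTo 1)

theorem compactSpace_subshift (X : SymbolicDynamics.FullShift.Subshift (Fin p) ℕ) :
    CompactSpace X.carrier := isCompact_iff_compactSpace.1 X.isClosed.isCompact

/-- The points of a subshift that start with `w 0, …, w (n - 1)`. -/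
def subshiftCylinder (X : SymbolicDynamics.FullShift.Subshift (Fin p) ℕ) (w : ℕ → Fin p) (n : ℕ) :
    Set X.carrier := Subtype.val ⁻¹' PiNat.cylinder w n

theorem mem_subshiftCylinder {X : SymbolicDynamics.FullShift.Subshift (Fin p) ℕ} {w : ℕ → Fin p}
    {n : ℕ} {x : X.carrier} : x ∈ subshiftCylinder X w n ↔ ∀ i < n, x.1 i = w i := Iff.rfl

theorem measurableSet_subshiftCylinder (X : SymbolicDynamics.FullShift.Subshift (Fin p) ℕ)
    (w : ℕ → Fin p) (n : ℕ) : MeasurableSet (subshiftCylinder X w n) :=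
  ((PiNat.isOpen_cylinder (fun _ => Fin p) w n).preimage continuous_subtype_val).measurableSet

theorem isTopologicalBasis_subshiftCylinder (X : SymbolicDynamics.FullShift.Subshift (Fin p) ℕ) :
    TopologicalSpace.IsTopologicalBasis
      (preimage Subtype.val '' {s | ∃ (w : ℕ → Fin p) (n : ℕ), s = PiNat.cylinder w n} :
        Set (Set X.carrier)) :=
  (PiNat.isTopologicalBasis_cylinders (fun _ => Fin p)).isInducing
    (Topology.IsInducing.subtypeVal)

/-- A finite measure on a subshift is determined by its values on cylinders. -/
theorem measure_ext_of_subshiftCylinder {X : SymbolicDynamics.FullShift.Subshift (Fin p) ℕ}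
    {μ ν : Measure X.carrier} [IsProbabilityMeasure μ] [IsProbabilityMeasure ν]
    (h : ∀ w n, μ (subshiftCylinder X w n) = ν (subshiftCylinder X w n)) : μ = ν := by
  refine ext_of_generate_finite _ ((BorelSpace.measurable_eq).trans
    (isTopologicalBasis_subshiftCylinder X).borel_eq_generateFrom) ?_ ?_ (by simp)
  · rintro _ ⟨_, ⟨w, n, rfl⟩, rfl⟩ _ ⟨_, ⟨w', n', rfl⟩, rfl⟩ ⟨y, hy, hy'⟩
    refine ⟨_, ⟨y.1, max n n', rfl⟩, ?_⟩
    ext z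
    have hy : ∀ i < n, y.1 i = w i := hy
    have hy' : ∀ i < n', y.1 i = w' i := hy'
    change (∀ i < max n n', z.1 i = y.1 i) ↔ (∀ i < n, z.1 i = w i) ∧ (∀ i < n', z.1 i = w' i)
    constructor
    · intro hz
      exact ⟨fun i hi => by rw [hz i (lt_max_of_lt_left hi), hy i hi],
        fun i hi => by rw [hz i (lt_max_of_lt_right hi), hy' i hi]⟩
    · rintro ⟨h1, h2⟩ i hi
      rcases lt_max_iff.1 hi with hi | hi
      · rw [h1 i hi, hy i hi]
      · rw [h2 i hi, hy' i hi]
  · rintro _ ⟨_, ⟨w, n, rfl⟩, rfl⟩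
    exact h w n

/-- A prefix of `y` of length `n + ℓ` determines all these visits and occurs in `a`. Counts uniform
over the windows of `a` thus hold at every point. -/
theorem exists_count_subshiftCylinder_eq {a : ℕ → Fin p} (y : (orbitClosure a).carrier)
    (w : ℕ → Fin p) (ℓ n : ℕ) [DecidablePred (· ∈ subshiftCylinder (orbitClosure a) w ℓ)] :
    ∃ s, Nat.count (fun i => (subshiftMap (orbitClosure a))^[i] y ∈
        subshiftCylinder (orbitClosure a) w ℓ) n =
      Nat.count (fun i => ∀ j < ℓ, a (s + i + j) = w j) n := by
  obtain ⟨s, hs⟩ := y.2 (n + ℓ)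
  refine ⟨s, ?_⟩
  simp only [Nat.count_eq_card_filter_range]
  refine congrArg Finset.card (Finset.filter_congr fun i hi => ?_)
  have hi := Finset.mem_range.1 hi
  rw [mem_subshiftCylinder]
  refine forall₂_congr fun j hj => ?_
  rw [subshiftMap_iterate_apply, hs _ (by omega), add_assoc]

/-- After each of the shifts `i < m`, at least `t` common letters remain. -/
theorem bowenDist_le_of_mem_subshiftCylinder {X : SymbolicDynamics.FullShift.Subshift (Fin p) ℕ}
    {w : ℕ → Fin p} {m t : ℕ} {y z : X.carrier} (hy : y ∈ subshiftCylinder X w (m + t))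
    (hz : z ∈ subshiftCylinder X w (m + t)) : bowenDist (subshiftMap X) m y z ≤ (1 / 2) ^ t := by
  rw [mem_subshiftCylinder] at hy hz
  have h : (Finset.range m).sup (fun i => nndist ((subshiftMap X)^[i] y) ((subshiftMap X)^[i] z)) ≤
      (1 / 2 : ℝ≥0) ^ t := by
    refine Finset.sup_le fun i hi => ?_
    have hi := Finset.mem_range.1 hi
    have hd : dist ((subshiftMap X)^[i] y).1 ((subshiftMap X)^[i] z).1 ≤ (1 / 2 : ℝ) ^ t := by
      refine PiNat.mem_cylinder_iff_dist_le.1 fun j hj => ?_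
      rw [subshiftMap_iterate_apply, subshiftMap_iterate_apply, hy _ (by omega), hz _ (by omega)]
    rw [← NNReal.coe_le_coe]
    simpa [Subtype.dist_eq] using hd
  have := NNReal.coe_le_coe.2 h
  simpa [bowenDist] using this

/-- The orbit closure of a uniformly recurrent sequence is minimal. -/
theorem isMinimalSystem_orbitClosure {a : ℕ → Fin p}
    (h : ∀ n s, ∃ W, ∀ s', ∃ o ≤ W, ∀ i < n, a (s' + o + i) = a (s + i)) :
    IsMinimalSystem (subshiftMap (orbitClosure a)) := by
  refine ⟨⟨⟨_, shift_mem_orbitClosure a 0⟩⟩, fun A hA hAT hAne => ?_⟩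
  obtain ⟨x, hx⟩ := hAne
  refine eq_univ_of_forall fun z => ?_
  rw [← hA.closure_eq, (isTopologicalBasis_subshiftCylinder _).mem_closure_iff]
  rintro _ ⟨_, ⟨w, n, rfl⟩, rfl⟩ hz
  have hz : ∀ i < n, z.1 i = w i := hz
  obtain ⟨s, hs⟩ := z.2 n
  obtain ⟨W, hW⟩ := h n s
  obtain ⟨s', hs'⟩ := x.2 (W + n)
  obtain ⟨o, ho, ho'⟩ := hW s'
  refine ⟨(subshiftMap (orbitClosure a))^[o] x, fun i hi => ?_, hAT.iterate o hx⟩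
  rw [subshiftMap_iterate_apply, hs' _ (by omega), ← add_assoc, ho' i hi, ← hs i hi, hz i hi]

/-- The orbit closure of a sequence with uniform frequencies is uniquely ergodic. -/
theorem isUniquelyErgodic_orbitClosure {a : ℕ → Fin p}
    (h : ∀ (w : ℕ → Fin p) (ℓ : ℕ), ∃ C : ℕ, ∀ k : ℕ, ∃ L n lo hi : ℕ, k < L ∧ 0 < n ∧
      (∀ s, lo ≤ Nat.count (fun i => ∀ j < ℓ, a (s + i + j) = w j) n ∧
        Nat.count (fun i => ∀ j < ℓ, a (s + i + j) = w j) n ≤ hi) ∧ hi * L ≤ lo * L + C * n) :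
    IsUniquelyErgodic (subshiftMap (orbitClosure a)) := by
  classical
  have := compactSpace_subshift (orbitClosure a)
  have : Nonempty (orbitClosure a).carrier := ⟨⟨_, shift_mem_orbitClosure a 0⟩⟩
  obtain ⟨μ₀, hμ₀⟩ := exists_isInvariantProbability (continuous_subshiftMap (orbitClosure a))
  have key : ∀ μ ν : Measure (orbitClosure a).carrier,
      IsInvariantProbability (subshiftMap (orbitClosure a)) μ →
      IsInvariantProbability (subshiftMap (orbitClosure a)) ν →
      ∀ w ℓ, μ.real (subshiftCylinder _ w ℓ) ≤ ν.real (subshiftCylinder _ w ℓ) := by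
    rintro μ ν ⟨hμ, hTμ⟩ ⟨hν, hTν⟩ w ℓ
    obtain ⟨C, hC⟩ := h w ℓ
    set V := subshiftCylinder (orbitClosure a) w ℓ
    have hV : MeasurableSet V := measurableSet_subshiftCylinder _ w ℓ
    by_contra! hlt
    -- The two measures of `V` can differ by at most `C / L`, and this choice makes that smaller
    -- than the assumed gap.
    obtain ⟨k, hk⟩ := exists_nat_gt (C / (μ.real V - ν.real V))
    obtain ⟨L, n, lo, hi, hkL, hn, hb, hhi⟩ := hC k
    have hb' : ∀ y, lo ≤ Nat.count (fun i => (subshiftMap (orbitClosure a))^[i] y ∈ V) n ∧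
        Nat.count (fun i => (subshiftMap (orbitClosure a))^[i] y ∈ V) n ≤ hi := fun y => by
      obtain ⟨s, hs⟩ := exists_count_subshiftCylinder_eq y w ℓ n
      rw [hs]
      exact hb s
    have h1 := ENNReal.toReal_mono (by simp) (hTμ.count_bounds hV hb').2
    have h2 := ENNReal.toReal_mono (by finiteness) (hTν.count_bounds hV hb').1
    simp only [ENNReal.toReal_mul, ENNReal.toReal_natCast] at h1 h2
    change n * μ.real V ≤ hi at h1
    change lo ≤ n * ν.real V at h2
    have h3 : (hi : ℝ) * L ≤ lo * L + C * n := by exact_mod_cast hhi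
    have hn' : (0 : ℝ) < n := by exact_mod_cast hn
    have hkL' : (k : ℝ) < L := by exact_mod_cast hkL
    rw [div_lt_iff₀ (by linarith)] at hk
    have h4 : n * μ.real V * L ≤ n * ν.real V * L + C * n := by
      have hL0 : (0 : ℝ) ≤ L := by positivity
      nlinarith
    have h5 : μ.real V * L ≤ ν.real V * L + C := by
      by_contra! hcon
      nlinarith
    nlinarith
  refine ⟨μ₀, hμ₀, fun ν hν => ?_⟩
  have := hμ₀.1
  have := hν.1
  refine measure_ext_of_subshiftCylinder fun w n => ?_
  rw [← measureReal_eq_measureReal_iff]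
  exact le_antisymm (key _ _ hν hμ₀ w n) (key _ _ hμ₀ hν w n)

/-- Exponentially many words of infinitely many lengths force positive entropy. -/
theorem one_le_coverEntropy {X : SymbolicDynamics.FullShift.Subshift (Fin p) ℕ}
    (h : ∃ᶠ n : ℕ in atTop, ∃ (N : ℕ) (x : Fin N → X.carrier), Real.exp n ≤ N ∧
      ∀ t t', (∀ i < n, (x t).1 i = (x t').1 i) → t = t') :
    1 ≤ Dynamics.coverEntropy (subshiftMap X) univ := by
  -- Distance below 1 means equal first letters, so a dynamical ball of order `n` for `U` is a
  -- cylinder of length `n` and covers at most one of the points `x t`.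
  set U : SetRel X.carrier X.carrier := {q | dist q.1 q.2 < 1} with hU
  have hUu : U ∈ uniformity X.carrier := Metric.dist_mem_uniformity one_pos
  refine le_trans ?_ (Dynamics.coverEntropyEntourage_le_coverEntropy _ _ hUu)
  refine Frequently.le_expGrowthSup (h.mono ?_)
  rintro n ⟨N, x, hN, hx⟩
  rw [one_mul]
  have hcard : (N : ℕ∞) ≤ Dynamics.coverMincard (subshiftMap X) univ U n := by
    refine le_iInf₂ fun s hs => ?_
    have hs' : ∀ t : Fin N, ∃ y ∈ s, ∀ i < n, (x t).1 i = y.1 i := by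
      intro t
      obtain ⟨y, hy, hxy⟩ := hs (mem_univ (x t))
      refine ⟨y, hy, fun i hi => ?_⟩
      have h1 := Dynamics.mem_dynEntourage.1 hxy i hi
      have h2 : dist ((subshiftMap X)^[i] (x t)).1 ((subshiftMap X)^[i] y).1 < (1 / 2 : ℝ) ^ 0 := by
        rw [pow_zero]; exact h1
      have h3 := PiNat.apply_eq_of_dist_lt h2 le_rfl
      simpa only [subshiftMap_iterate_apply, add_zero] using h3
    choose g hg hg' using hs'
    have : Fintype.card (Fin N) ≤ s.card := by
      rw [← Finset.card_univ]
      refine Finset.card_le_card_of_injOn g (fun t _ => hg t) fun t _ t' _ htt => hx t t' ?_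
      intro i hi
      rw [hg' t i hi, hg' t' i hi, htt]
    rw [Fintype.card_fin] at this
    exact_mod_cast this
  have h1 : ((N : ℕ∞) : ℝ≥0∞) ≤ (Dynamics.coverMincard (subshiftMap X) univ U n : ℝ≥0∞) :=
    ENat.toENNReal_le.2 hcard
  refine le_trans ?_ h1
  have h2 := ENNReal.ofReal_le_ofReal hN
  rw [ENNReal.ofReal_natCast] at h2
  exact (EReal.exp_coe (n : ℝ)).trans_le h2

end OrbitClosure

/-! ### Words of polynomially small frequency -/

section Frequencies

variable {p : ℕ} (hp : 2 ^ 12 ≤ p)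

-- The run fills at least the fraction `2 ^ -(k + 5)` of every block of level `k + 1`.
include hp in
theorem blockLen_succ_le (k : ℕ) :
    blockLen p (k + 1) ≤ 2 ^ (k + 5) * (blockReps p k * blockLen p k) := by
  have h1 := blockCount_le_blockReps_mul hp k
  have h2 : blockReps p k ≤ blockReps p k * 2 ^ (k + 4) :=
    Nat.le_mul_of_pos_right _ (by positivity)
  calc blockLen p (k + 1) ≤ (blockReps p k * 2 ^ (k + 4) + blockReps p k * 2 ^ (k + 4)) *
        blockLen p k := Nat.mul_le_mul_right _ (Nat.add_le_add h2 h1)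
    _ = _ := by ring

include hp in
/-- The level of the blocks whose powers are used as words of length `n`. -/
theorem exists_level {n : ℕ} (hn : 0 < n) : ∃ k, 2 * n ≤ blockReps p k * blockLen p k ∧
    2 ^ (k + 8) * blockLen p k ≤ 2 ^ 18 * n ^ 2 := by
  classical
  have hex : ∃ k, 2 * n ≤ blockReps p k * blockLen p k := by
    have h1 := self_lt_blockLen hp (2 * n)
    have h2 := blockReps_pos hp (2 * n)
    exact ⟨2 * n, by nlinarith⟩
  refine ⟨Nat.find hex, Nat.find_spec hex, ?_⟩
  rcases hk : Nat.find hex with _ | k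
  · simp only [blockLen]
    have : 1 ≤ n ^ 2 := Nat.one_le_pow 2 n hn
    omega
  -- At the least suitable level the previous run is too short, which bounds the block length by `2
  -- ^ (k + 5) * (2 * n)`. Since lengths are at least `2 ^ (4 * (k + 1))`, the powers of `2 ^ k` are
  -- themselves polynomial in `n`.
  · have hlt : blockReps p k * blockLen p k < 2 * n := by
      by_contra! hcon
      exact Nat.find_min hex (m := k) (by omega) hcon
    have h1 : blockLen p (k + 1) ≤ 2 ^ (k + 5) * (2 * n) :=
      (blockLen_succ_le hp k).trans (Nat.mul_le_mul_left _ hlt.le)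
    have h2 := two_pow_le_blockLen hp (k + 1)
    have h3 : 2 ^ (k + 5) * 2 ^ (3 * k) ≤ 2 ^ (k + 5) * (4 * n) := by
      calc 2 ^ (k + 5) * 2 ^ (3 * k) = 2 * 2 ^ (4 * (k + 1)) := by
            rw [← pow_add, ← pow_succ']; congr 1; omega
        _ ≤ 2 * (2 ^ (k + 5) * (2 * n)) := Nat.mul_le_mul_left _ (h2.trans h1)
        _ = _ := by ring
    have h4 : 2 ^ (3 * k) ≤ 4 * n := Nat.le_of_mul_le_mul_left h3 (by positivity)
    have h5 : 2 ^ (2 * k) ≤ 2 ^ (3 * k) := Nat.pow_le_pow_right (by norm_num) (by omega)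
    calc 2 ^ (k + 1 + 8) * blockLen p (k + 1) ≤ 2 ^ (k + 1 + 8) * (2 ^ (k + 5) * (2 * n)) :=
          Nat.mul_le_mul_left _ h1
      _ = 2 ^ 15 * n * 2 ^ (2 * k) := by ring
      _ ≤ 2 ^ 15 * n * (4 * n) := Nat.mul_le_mul_left _ (h5.trans h4)
      _ ≤ 2 ^ 18 * n ^ 2 := by nlinarith

variable [NeZero p]

include hp in
/-- There are words of length `n` whose frequencies are bounded below by a power of `n`. -/
theorem exists_frequent_word {n : ℕ} (hn : 0 < n) : ∃ (w : ℕ → Fin p) (R W : ℕ), 0 < W ∧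
    (∀ s, R ≤ Nat.count (fun i => ∀ j < n, blockLimit p (s + i + j) = w j) W) ∧
    W ≤ 2 ^ 18 * n ^ 2 * R := by
  obtain ⟨k, hk1, hk2⟩ := exists_level hp hn
  -- The word is a prefix of the periodic repetition of the block `0` of level `k`, as read inside
  -- the runs.
  refine ⟨fun j => block p k 0 (j % blockLen p k), (blockReps p k + 1) / 2,
    2 * blockLen p (k + 1), Nat.mul_pos two_pos (blockLen_pos hp _), fun s => ?_, ?_⟩
  · have := blockReps_le_two_mul_count hp hk1 s
    dsimp only
    omega
  · have h1 := blockLen_succ_le hp k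
    have h2 : blockReps p k ≤ 2 * ((blockReps p k + 1) / 2) := by omega
    calc 2 * blockLen p (k + 1) ≤ 2 * (2 ^ (k + 5) * (blockReps p k * blockLen p k)) :=
          Nat.mul_le_mul_left _ h1
      _ ≤ 2 * (2 ^ (k + 5) * (2 * ((blockReps p k + 1) / 2) * blockLen p k)) := by gcongr
      _ = 2 ^ (k + 7) * blockLen p k * ((blockReps p k + 1) / 2) := by ring
      _ ≤ 2 ^ (k + 8) * blockLen p k * ((blockReps p k + 1) / 2) := by
          gcongr <;> omega
      _ ≤ _ := Nat.mul_le_mul_right _ hk2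

theorem eventually_exp_neg_le_inv_pow (t : ℕ) {η : ℝ} (hη : 0 < η) (c : ℝ) :
    ∀ᶠ m : ℕ in atTop, Real.exp (-(η * m)) * (c * ((m + t : ℕ) : ℝ) ^ 4) ≤ 1 := by
  have h := (isLittleO_pow_exp_pos_mul_atTop 4 hη).comp_tendsto
    ((tendsto_natCast_atTop_atTop (R := ℝ)).comp (tendsto_add_atTop_nat t))
  have hc : 0 < ((|c| + 1) * Real.exp (η * t))⁻¹ := by positivity
  filter_upwards [h.bound hc] with m hm
  simp only [Function.comp, norm_pow, Real.norm_eq_abs, Nat.abs_cast, Real.abs_exp] at hm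
  have hsplit : Real.exp (η * (m + t : ℕ)) = Real.exp (η * m) * Real.exp (η * t) := by
    rw [← Real.exp_add]; congr 1; push_cast; ring
  rw [hsplit, inv_mul_eq_div, le_div_iff₀ (by positivity)] at hm
  have h2 : ((m + t : ℕ) : ℝ) ^ 4 * (|c| + 1) ≤ Real.exp (η * m) :=
    le_of_mul_le_mul_right (by linarith) (Real.exp_pos (η * t))
  rw [Real.exp_neg, inv_mul_le_iff₀ (Real.exp_pos _), mul_one]
  refine le_trans ?_ h2
  rw [mul_comm]
  gcongr
  linarith [le_abs_self c]

end Frequencies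

/-! ### Assembly -/

theorem theoremC :
    ∃ (p : ℕ) (X : SymbolicDynamics.FullShift.Subshift (Fin p) ℕ),
      2 ≤ p ∧ X.carrier.Nonempty ∧
      IsStrictlyErgodic (subshiftMap X) ∧
      0 < Dynamics.coverEntropy (subshiftMap X) univ ∧
      (∀ y : X.carrier, HasLocalCorrelationEntropy (subshiftMap X) y 0) ∧
      ∀ μ : Measure X.carrier, IsInvariantProbability (subshiftMap X) μ →
        HasCorrelationEntropy (subshiftMap X) μ 0 := by
  obtain ⟨p, hp⟩ : ∃ p : ℕ, 2 ^ 12 ≤ p := ⟨_, le_rfl⟩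
  have : NeZero p := ⟨by omega⟩
  refine ⟨p, orbitClosure (blockLimit p), by omega, ⟨_, shift_mem_orbitClosure _ 0⟩,
    ⟨isMinimalSystem_orbitClosure (exists_prefix_occurrence hp),
      isUniquelyErgodic_orbitClosure fun w ℓ => ⟨2 * ℓ + 2, fun k => ?_⟩⟩,
    lt_of_lt_of_le zero_lt_one (one_le_coverEntropy ?_),
    hasCorrelationEntropy_zero_of_frequent_sets ?_⟩
  · obtain ⟨n, lo, hi, h⟩ := exists_window_count_bounds hp w ℓ k
    exact ⟨blockLen p k, n, lo, hi, self_lt_blockLen hp k, h⟩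
  · refine frequently_atTop.2 fun k => ⟨blockLen p k, (self_lt_blockLen hp k).le,
      blockCount p k, ?_⟩
    choose s hs using fun t : Fin (blockCount p k) => exists_block_occurrence hp t.2
    refine ⟨fun t => ⟨_, shift_mem_orbitClosure (blockLimit p) (s t)⟩,
      exp_blockLen_le_blockCount hp k, fun t t' h => ?_⟩
    by_contra hne
    obtain ⟨i, hi, hb⟩ := exists_block_ne hp t.2 t'.2 (fun h => hne (Fin.ext h))
    exact hb (by rw [← hs t i hi, ← hs t' i hi]; exact h i hi)
  · intro ε hε η hη
    obtain ⟨t, ht⟩ := exists_pow_lt_of_lt_one hε (show (1 / 2 : ℝ) < 1 by norm_num)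
    -- The word has length `m + t`, the extra `t` letters giving precision `ε`. The constant is `2 ^
    -- 38 = (2 * 2 ^ 18) ^ 2`, and the fourth power of the length is the square of the quadratic
    -- bound on `W / R`.
    filter_upwards [eventually_exp_neg_le_inv_pow t hη (2 ^ 38), eventually_gt_atTop 0]
      with m hm hm0
    obtain ⟨w, R, W, hW, hR, hRW⟩ := exists_frequent_word hp (show 0 < m + t by omega)
    refine ⟨subshiftCylinder _ w (m + t), R, W, measurableSet_subshiftCylinder _ _ _,
      fun y hy z hz => (bowenDist_le_of_mem_subshiftCylinder hy hz).trans ht.le, hW, ?_, ?_⟩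
    · intro _ y
      obtain ⟨s, hs⟩ := exists_count_subshiftCylinder_eq y w (m + t) W
      rw [hs]
      exact hR s
    · have hW' : (0 : ℝ) < W := by exact_mod_cast hW
      have hRW' : (W : ℝ) ≤ 2 ^ 18 * ((m + t : ℕ) : ℝ) ^ 2 * R := by exact_mod_cast hRW
      rw [div_pow, le_div_iff₀ (by positivity)]
      calc Real.exp (-(η * m)) * (2 * W : ℝ) ^ 2
          ≤ Real.exp (-(η * m)) * (2 * (2 ^ 18 * ((m + t : ℕ) : ℝ) ^ 2 * R)) ^ 2 := by gcongr
        _ = Real.exp (-(η * m)) * (2 ^ 38 * ((m + t : ℕ) : ℝ) ^ 4) * R ^ 2 := by ring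
        _ ≤ 1 * (R : ℝ) ^ 2 := by gcongr
        _ = _ := one_mul _
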